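/- Let $(S_n)_{n\in\mathbb Z}$ and $(T_n)_{n\in\mathbb Z}$ be the two Somos-5 sequences, both generated by $\tau_{n+5}\tau_n=\tau_{n+4}\tau_{n+1}+\tau_{n+3}\tau_{n+2}$: $S_0,\dots,S_4=1,1,1,2,3$ with $S_{-n}=S_n$, and $T_0=0$, $T_1,\dots,T_5=1,-1,1,1,-7$ with $T_{-n}=-T_n$. For $n\in\mathbb Z$ define the signed lengths $$\bar s_n=-S_{n+3}S_{n+4}^2T_n^2T_{n+1},\quad \bar a_n=-S_{n+2}T_{n+1}T_{n+2}^3T_{n+3},\quad \bar b_n=S_{n+1}S_{n+2}^3S_{n+3}T_{n+2},\quad \bar c_n=S_n^2S_{n+1}T_{n+3}T_{n+4}^2,$$ the signed medians $$\bar k_n=\tfrac12 S_{n+4}T_{n+4}\left(T_nT_{n+1}^2T_{n+2}-S_nS_{n+1}^2S_{n+2}\right),\qquad \bar\ell_n=\tfrac12 S_nT_n\left(S_{n+2}S_{n+3}^2S_{n+4}-T_{n+2}T_{n+3}^2T_{n+4}\right),$$ the signed area $$\Delta_n=S_nS_{n+1}S_{n+2}^2S_{n+3}S_{n+4}\,T_nT_{n+1}T_{n+2}^2T_{n+3}T_{n+4},$$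 and the Schubert parameters with signs $$P_{a,n}=-\frac{S_{n+1}S_{n+2}T_{n+1}T_{n+2}}{S_nS_{n+3}T_nT_{n+3}},\qquad M_{b,n}=\frac{S_{n+1}S_{n+4}T_{n+1}T_{n+4}}{S_{n+2}S_{n+3}T_{n+2}T_{n+3}}.$$ Put $$D_n=4(\bar s_n-\bar c_n)\bar k_n+(\bar s_n-\bar a_n)^2-(\bar s_n-\bar b_n)^2-3(\bar s_n-\bar c_n)^2,$$ $$N_n=4(\bar s_n-\bar c_n)\bar\ell_n-(\bar s_n-\bar b_n)^2+3(\bar s_n-\bar c_n)^2+(\bar s_n-\bar a_n)^2.$$ Then, for all $n\in\mathbb Z$, the signed medians satisfy $$P_{a,n}=\frac{4\Delta_n}{D_n},\qquad M_{b,n}=\frac{N_n}{4\Delta_n}.$$ Precisely: the first relation holds between rational numbers, with the denominators of both sides non-zero, for every integer $n\notin\{-4,-3,-2,0\}$, and so does the second for every integer $n\notin\{-4,-3,-2,-1,0\}$; and for every $n\in\mathbb Z$, including the exceptional values, both hold in the form in which denominators and all common factors have been cleared, namely $$D_n=-4\,(S_nS_{n+3}T_nT_{n+3})^2\,S_{n+2}S_{n+4}T_{n+2}T_{n+4},\qquad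 N_n=4\,(S_{n+1}S_{n+4}T_{n+1}T_{n+4})^2\,S_nS_{n+2}T_nT_{n+2}.$$ -/

import Mathlib

namespace MainSequence

/-- The solution `τ 0, τ 1, τ 2, …` of the Somos-5 recurrence
`τ (m+5) * τ m = τ (m+4) * τ (m+1) + τ (m+3) * τ (m+2)` with prescribed first five terms,
obtained by solving for the highest term. -/
def somosFive (a₀ a₁ a₂ a₃ a₄ : ℚ) : ℕ → ℚ
  | 0 => a₀
  | 1 => a₁
  | 2 => a₂
  | 3 => a₃
  | 4 => a₄
  | m + 5 =>
      (somosFive a₀ a₁ a₂ a₃ a₄ (m + 4) * somosFive a₀ a₁ a₂ a₃ a₄ (m + 1)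
        + somosFive a₀ a₁ a₂ a₃ a₄ (m + 3) * somosFive a₀ a₁ a₂ a₃ a₄ (m + 2))
        / somosFive a₀ a₁ a₂ a₃ a₄ m

/-- The sequence `1, 1, 1, 2, 3, 5, 11, 37, 83, 274, …` (starting from the index `0`),
extended to negative indices by `S (-n) = S n`. -/
def S (n : ℤ) : ℚ := somosFive 1 1 1 2 3 n.natAbs

/-- The sequence `0, 1, -1, 1, 1, -7, 8, -1, -57, 391, …` (starting from the index `0`),
extended to negative indices by `T (-n) = - T n`. Since `T 0 = 0`, the recurrence is started from
the five values `T 1, …, T 5`; the factor `n.sign` gives `T 0 = 0` and the antisymmetry. -/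
def T (n : ℤ) : ℚ := (n.sign : ℚ) * somosFive 1 (-1) 1 1 (-7) (n.natAbs - 1)

/-- Signed lengths: the signed counterpart of the semiperimeter `s`. -/
def sBar (n : ℤ) : ℚ := -(S (n + 3) * S (n + 4) ^ 2 * T n ^ 2 * T (n + 1))

/-- Signed lengths: the signed counterpart of `s - a`. -/
def aBar (n : ℤ) : ℚ := -(S (n + 2) * T (n + 1) * T (n + 2) ^ 3 * T (n + 3))

/-- Signed lengths: the signed counterpart of `s - b`. -/
def bBar (n : ℤ) : ℚ := S (n + 1) * S (n + 2) ^ 3 * S (n + 3) * T (n + 2)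

/-- Signed lengths: the signed counterpart of `s - c`. -/
def cBar (n : ℤ) : ℚ := S n ^ 2 * S (n + 1) * T (n + 3) * T (n + 4) ^ 2

/-- The signed median `k`. -/
def kBar (n : ℤ) : ℚ :=
  1 / 2 * S (n + 4) * T (n + 4)
    * (T n * T (n + 1) ^ 2 * T (n + 2) - S n * S (n + 1) ^ 2 * S (n + 2))

/-- The signed median `ℓ`. -/
def lBar (n : ℤ) : ℚ :=
  1 / 2 * S n * T n
    * (S (n + 2) * S (n + 3) ^ 2 * S (n + 4) - T (n + 2) * T (n + 3) ^ 2 * T (n + 4))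

/-- The signed area. -/
def area (n : ℤ) : ℚ :=
  S n * S (n + 1) * S (n + 2) ^ 2 * S (n + 3) * S (n + 4)
    * T n * T (n + 1) * T (n + 2) ^ 2 * T (n + 3) * T (n + 4)

/-- The Schubert parameter (with sign) `P_{a,n}`; it is infinite for `n = 0` and `n = -3`. -/
def Pa (n : ℤ) : ℚ :=
  -((S (n + 1) * S (n + 2) * T (n + 1) * T (n + 2)) / (S n * S (n + 3) * T n * T (n + 3)))

/-- The Schubert parameter (with sign) `M_{b,n}`; it is infinite for `n = -2` and `n = -3`. -/
def Mb (n : ℤ) : ℚ :=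
  (S (n + 1) * S (n + 4) * T (n + 1) * T (n + 4)) / (S (n + 2) * S (n + 3) * T (n + 2) * T (n + 3))

/-- The signed version of `4ck + a² - b² - 3c²`. -/
def kExpr (n : ℤ) : ℚ :=
  4 * (sBar n - cBar n) * kBar n + (sBar n - aBar n) ^ 2 - (sBar n - bBar n) ^ 2
    - 3 * (sBar n - cBar n) ^ 2

/-- The signed version of `4cℓ - b² + 3c² + a²`. -/
def lExpr (n : ℤ) : ℚ :=
  4 * (sBar n - cBar n) * lBar n - (sBar n - bBar n) ^ 2 + 3 * (sBar n - cBar n) ^ 2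
    + (sBar n - aBar n) ^ 2

end MainSequence

namespace MainSequence

/-- The relations between three consecutive terms of the pair `(S, T)`; the parameter `l` is `1` or
`2` according to the parity of the middle index. -/
structure Adjacent (l s₀ t₀ s₁ t₁ s₂ t₂ : ℚ) : Prop where
  ss : (2 * l - 1) * (s₀ * s₂) = l * s₁ ^ 2 + t₁ ^ 2
  tt : (2 * l - 1) * (t₀ * t₂) = (3 - l) * t₁ ^ 2 - s₁ ^ 2
  st : (2 * l - 1) * (s₀ * t₂ + s₂ * t₀) = -3 * (s₁ * t₁)

namespace Adjacent

variable {l s₀ t₀ s₁ t₁ s₂ t₂ s₃ t₃ s₄ t₄ s₅ t₅ : ℚ}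

/-- Reflection of the index. -/
theorem reflect (h : Adjacent l s₀ t₀ s₁ t₁ s₂ t₂) :
    Adjacent l s₂ (-t₂) s₁ (-t₁) s₀ (-t₀) where
  ss := by linear_combination h.ss
  tt := by linear_combination h.tt
  st := by linear_combination -h.st

theorem succ (hl : l = 1 ∨ l = 2) (h : Adjacent (3 - l) s₀ t₀ s₁ t₁ s₂ t₂)
    (hs : s₁ ≠ 0) (ht : t₁ ≠ 0)
    (hss : (2 * l - 1) * (s₁ * s₃) = l * s₂ ^ 2 + t₂ ^ 2)
    (htt : (2 * l - 1) * (t₁ * t₃) = (3 - l) * t₂ ^ 2 - s₂ ^ 2) :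
    Adjacent l s₁ t₁ s₂ t₂ s₃ t₃ := by
  refine ⟨hss, htt, ?_⟩
  obtain ⟨h1, h2, h3⟩ := h
  apply mul_left_cancel₀ (mul_ne_zero hs ht)
  rcases hl with rfl | rfl
  · linear_combination t₁ ^ 2 * hss + s₁ ^ 2 * htt + s₂ * t₂ * h3 - s₂ ^ 2 * h2 - t₂ ^ 2 * h1
  · linear_combination t₁ ^ 2 * hss + s₁ ^ 2 * htt + s₂ * t₂ * h3 - s₂ ^ 2 * h2 - t₂ ^ 2 * h1

theorem tt_four (ht : t₁ ≠ 0) (hl : l = 1 ∨ l = 2) (h : Adjacent l s₀ t₀ s₁ t₁ s₂ t₂)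
    (h' : Adjacent (3 - l) s₁ t₁ s₂ t₂ s₃ t₃) : t₃ * t₀ = s₁ * s₂ + t₁ * t₂ := by
  obtain ⟨h1, h2, h3⟩ := h
  obtain ⟨h4, h5, h6⟩ := h'
  apply mul_left_cancel₀ ht
  rcases hl with rfl | rfl <;> grind

theorem ss_four (hs : s₁ ≠ 0) (hl : l = 1 ∨ l = 2) (h : Adjacent l s₀ t₀ s₁ t₁ s₂ t₂)
    (h' : Adjacent (3 - l) s₁ t₁ s₂ t₂ s₃ t₃) : s₃ * s₀ = s₁ * s₂ - t₁ * t₂ := by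
  obtain ⟨h1, h2, h3⟩ := h
  obtain ⟨h4, h5, h6⟩ := h'
  apply mul_left_cancel₀ hs
  rcases hl with rfl | rfl <;> grind

theorem ts_four (hs : t₁ ≠ 0) (hl : l = 1 ∨ l = 2) (h : Adjacent l s₀ t₀ s₁ t₁ s₂ t₂)
    (h' : Adjacent (3 - l) s₁ t₁ s₂ t₂ s₃ t₃) : t₃ * s₀ = -(l * (s₁ * t₂) + s₂ * t₁) := by
  obtain ⟨h1, h2, h3⟩ := h
  obtain ⟨h4, h5, h6⟩ := h'
  apply mul_left_cancel₀ hs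
  rcases hl with rfl | rfl <;> grind

theorem st_four (hs : s₁ ≠ 0) (hl : l = 1 ∨ l = 2) (h : Adjacent l s₀ t₀ s₁ t₁ s₂ t₂)
    (h' : Adjacent (3 - l) s₁ t₁ s₂ t₂ s₃ t₃) : s₃ * t₀ = -(s₁ * t₂ + (3 - l) * (s₂ * t₁)) := by
  obtain ⟨h1, h2, h3⟩ := h
  obtain ⟨h4, h5, h6⟩ := h'
  apply mul_left_cancel₀ hs
  rcases hl with rfl | rfl <;> grind

/-- Six consecutive pairs satisfy the Somos-5 recurrence. -/
theorem somos (hl : l = 1 ∨ l = 2) (h₁ : Adjacent (3 - l) s₀ t₀ s₁ t₁ s₂ t₂)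
    (h₂ : Adjacent l s₁ t₁ s₂ t₂ s₃ t₃) (h₃ : Adjacent (3 - l) s₂ t₂ s₃ t₃ s₄ t₄)
    (h₄ : Adjacent l s₃ t₃ s₄ t₄ s₅ t₅) (hs₁ : s₁ ≠ 0) (hs₂ : s₂ ≠ 0) (hs₃ : s₃ ≠ 0)
    (ht₁ : t₁ ≠ 0) (ht₂ : t₂ ≠ 0) (ht₃ : t₃ ≠ 0) :
    s₅ * s₀ = s₄ * s₁ + s₃ * s₂ ∧ t₅ * t₀ = t₄ * t₁ + t₃ * t₂ := by
  have hl' : 3 - l = 1 ∨ 3 - l = 2 := by rcases hl with rfl | rfl <;> norm_num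
  have h₂' : Adjacent (3 - (3 - l)) s₁ t₁ s₂ t₂ s₃ t₃ := by rwa [sub_sub_cancel]
  have h₄' : Adjacent (3 - (3 - l)) s₃ t₃ s₄ t₄ s₅ t₅ := by rwa [sub_sub_cancel]
  have a1 := tt_four ht₁ hl' h₁ h₂'
  have a2 := ss_four hs₁ hl' h₁ h₂'
  have b1 := tt_four ht₂ hl h₂ h₃
  have b2 := ss_four hs₂ hl h₂ h₃
  have b3 := ts_four ht₂ hl h₂ h₃
  have b4 := st_four hs₂ hl h₂ h₃
  have c1 := tt_four ht₃ hl' h₃ h₄'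
  have c2 := ss_four hs₃ hl' h₃ h₄'
  have e : (3 - l) * t₂ ^ 2 * s₃ ^ 2 - s₂ ^ 2 * s₃ ^ 2 + l * s₂ ^ 2 * t₃ ^ 2 + t₂ ^ 2 * t₃ ^ 2
      + 3 * (s₂ * t₂ * s₃ * t₃) = 0 := by
    linear_combination -s₃ ^ 2 * h₂.tt - t₃ ^ 2 * h₂.ss + s₃ * t₃ * h₂.st
  constructor
  · apply mul_left_cancel₀ (mul_ne_zero hs₂ hs₃)
    rcases hl with rfl | rfl <;> grind
  · apply mul_left_cancel₀ (mul_ne_zero ht₂ ht₃)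
    rcases hl with rfl | rfl <;> grind

/-- The relations propagate along solutions of the Somos-5 recurrence. -/
theorem of_somos (hl : l = 1 ∨ l = 2) (h₁ : Adjacent (3 - l) s₀ t₀ s₁ t₁ s₂ t₂)
    (h₂ : Adjacent l s₁ t₁ s₂ t₂ s₃ t₃) (h₃ : Adjacent (3 - l) s₂ t₂ s₃ t₃ s₄ t₄)
    (hs₀ : s₀ ≠ 0) (hs₁ : s₁ ≠ 0) (hs₂ : s₂ ≠ 0) (hs₃ : s₃ ≠ 0)
    (ht₀ : t₀ ≠ 0) (ht₁ : t₁ ≠ 0) (ht₂ : t₂ ≠ 0) (ht₃ : t₃ ≠ 0)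
    (hs : s₅ * s₀ = s₄ * s₁ + s₃ * s₂) (ht : t₅ * t₀ = t₄ * t₁ + t₃ * t₂) :
    Adjacent l s₃ t₃ s₄ t₄ s₅ t₅ := by
  have hk : 2 * l - 1 ≠ 0 := by rcases hl with rfl | rfl <;> norm_num
  have h₄ : Adjacent l s₃ t₃ s₄ t₄ ((l * s₄ ^ 2 + t₄ ^ 2) / ((2 * l - 1) * s₃))
      (((3 - l) * t₄ ^ 2 - s₄ ^ 2) / ((2 * l - 1) * t₃)) :=
    succ hl h₃ hs₃ ht₃ (by field_simp) (by field_simp)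
  obtain ⟨es, et⟩ := somos hl h₁ h₂ h₃ h₄ hs₁ hs₂ hs₃ ht₁ ht₂ ht₃
  rw [mul_right_cancel₀ hs₀ (es.trans hs.symm), mul_right_cancel₀ ht₀ (et.trans ht.symm)] at h₄
  exact h₄

end Adjacent

theorem somosFive_add_five (a₀ a₁ a₂ a₃ a₄ : ℚ) (m : ℕ) :
    somosFive a₀ a₁ a₂ a₃ a₄ (m + 5) =
      (somosFive a₀ a₁ a₂ a₃ a₄ (m + 4) * somosFive a₀ a₁ a₂ a₃ a₄ (m + 1)
        + somosFive a₀ a₁ a₂ a₃ a₄ (m + 3) * somosFive a₀ a₁ a₂ a₃ a₄ (m + 2))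
        / somosFive a₀ a₁ a₂ a₃ a₄ m := by
  rw [somosFive]

/-- `S` on the natural numbers. -/
def natS (m : ℕ) : ℚ := somosFive 1 1 1 2 3 m

/-- `T` on the positive integers, shifted by one. -/
def natT (m : ℕ) : ℚ := somosFive 1 (-1) 1 1 (-7) m

theorem natS_pos (m : ℕ) : 0 < natS m := by
  suffices h : 0 < natS m ∧ 0 < natS (m + 1) ∧ 0 < natS (m + 2) ∧ 0 < natS (m + 3) ∧
      0 < natS (m + 4) from h.1
  induction m with
  | zero => simp [natS, somosFive]
  | succ k ih =>
    obtain ⟨h0, h1, h2, h3, h4⟩ := ih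
    refine ⟨h1, h2, h3, h4, ?_⟩
    have e : natS (k + 5) =
        (natS (k + 4) * natS (k + 1) + natS (k + 3) * natS (k + 2)) / natS k :=
      somosFive_add_five ..
    have : 0 < natS (k + 5) := by rw [e]; positivity
    exact this

theorem natS_somos (k : ℕ) :
    natS (k + 5) * natS k = natS (k + 4) * natS (k + 1) + natS (k + 3) * natS (k + 2) := by
  have e : natS (k + 5) =
      (natS (k + 4) * natS (k + 1) + natS (k + 3) * natS (k + 2)) / natS k :=
    somosFive_add_five ..
  rw [e, div_mul_cancel₀ _ (natS_pos k).ne']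

theorem natT_somos {k : ℕ} (h : natT k ≠ 0) :
    natT (k + 5) * natT k = natT (k + 4) * natT (k + 1) + natT (k + 3) * natT (k + 2) := by
  have e : natT (k + 5) =
      (natT (k + 4) * natT (k + 1) + natT (k + 3) * natT (k + 2)) / natT k :=
    somosFive_add_five ..
  rw [e, div_mul_cancel₀ _ h]

theorem natS_mono_aux (k : ℕ) : natS k ≤ natS (k + 1) := by
  suffices h : natS k ≤ natS (k + 1) ∧ natS (k + 1) ≤ natS (k + 2) ∧ natS (k + 2) ≤ natS (k + 3) ∧
      natS (k + 3) ≤ natS (k + 4) from h.1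
  induction k with
  | zero => norm_num [natS, somosFive]
  | succ k ih =>
    obtain ⟨h0, h1, h2, h3⟩ := ih
    refine ⟨h1, h2, h3, ?_⟩
    have e := natS_somos k
    have : natS (k + 4) ≤ natS (k + 5) := by
      by_contra! hc
      nlinarith [natS_pos k, natS_pos (k + 2), natS_pos (k + 3), natS_pos (k + 4),
        mul_lt_mul_of_pos_right hc (natS_pos k), mul_le_mul_of_nonneg_left h0 (natS_pos (k + 4)).le,
        mul_pos (natS_pos (k + 3)) (natS_pos (k + 2))]
    exact this

theorem natS_mono : Monotone natS := monotone_nat_of_le_succ natS_mono_aux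

/-- Division step of the Laurent phenomenon for the Somos-5 recurrence. -/
theorem dvd_of_somosFive {x₀ x₁ x₂ x₃ x₄ x₅ x₆ x₇ x₈ x₉ : ℤ}
    (h₀ : x₅ * x₀ = x₄ * x₁ + x₃ * x₂) (h₁ : x₆ * x₁ = x₅ * x₂ + x₄ * x₃)
    (h₂ : x₇ * x₂ = x₆ * x₃ + x₅ * x₄) (h₃ : x₈ * x₃ = x₇ * x₄ + x₆ * x₅)
    (h₄ : x₉ * x₄ = x₈ * x₅ + x₇ * x₆) (c₁ : IsCoprime x₅ x₁) (c₂ : IsCoprime x₅ x₂)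
    (c₃ : IsCoprime x₅ x₃) (c₄ : IsCoprime x₅ x₄) : x₅ ∣ x₉ * x₆ + x₈ * x₇ := by
  have c : IsCoprime x₅ (x₁ ^ 2 * x₂ * x₃ * x₄) :=
    (((c₁.pow_right).mul_right c₂).mul_right c₃).mul_right c₄
  refine c.dvd_of_dvd_mul_left ?_
  have e₀ : x₄ * x₁ + x₃ * x₂ ≡ 0 [ZMOD x₅] := by
    rw [← h₀]; exact Int.modEq_zero_iff_dvd.2 (dvd_mul_right _ _)
  have e₁ : x₆ * x₁ ≡ x₄ * x₃ [ZMOD x₅] := by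
    rw [h₁]; exact (Int.modEq_iff_dvd.2 ⟨-x₂, by ring⟩)
  have e₂ : x₇ * x₂ ≡ x₆ * x₃ [ZMOD x₅] := by
    rw [h₂]; exact (Int.modEq_iff_dvd.2 ⟨-x₄, by ring⟩)
  have e₃ : x₈ * x₃ ≡ x₇ * x₄ [ZMOD x₅] := by
    rw [h₃]; exact (Int.modEq_iff_dvd.2 ⟨-x₆, by ring⟩)
  have e₄ : x₉ * x₄ ≡ x₇ * x₆ [ZMOD x₅] := by
    rw [h₄]; exact (Int.modEq_iff_dvd.2 ⟨-x₈, by ring⟩)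
  apply Int.modEq_zero_iff_dvd.1
  calc x₁ ^ 2 * x₂ * x₃ * x₄ * (x₉ * x₆ + x₈ * x₇)
      = x₁ ^ 2 * x₂ * x₃ * x₆ * (x₉ * x₄) + x₁ ^ 2 * x₂ * x₄ * x₇ * (x₈ * x₃) := by ring
    _ ≡ x₁ ^ 2 * x₂ * x₃ * x₆ * (x₇ * x₆) + x₁ ^ 2 * x₂ * x₄ * x₇ * (x₇ * x₄) [ZMOD x₅] :=
        (e₄.mul_left _).add (e₃.mul_left _)
    _ = x₇ * x₂ * x₃ * (x₆ * x₁) * (x₆ * x₁) + x₁ ^ 2 * x₄ ^ 2 * x₇ * (x₇ * x₂) := by ring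
    _ ≡ x₇ * x₂ * x₃ * (x₄ * x₃) * (x₄ * x₃) + x₁ ^ 2 * x₄ ^ 2 * x₇ * (x₆ * x₃) [ZMOD x₅] :=
        (((e₁.mul_left _).mul e₁)).add (e₂.mul_left _)
    _ = x₇ * x₂ * x₃ ^ 3 * x₄ ^ 2 + x₁ * x₄ ^ 2 * x₃ * x₇ * (x₆ * x₁) := by ring
    _ ≡ x₇ * x₂ * x₃ ^ 3 * x₄ ^ 2 + x₁ * x₄ ^ 2 * x₃ * x₇ * (x₄ * x₃) [ZMOD x₅] :=
        (Int.ModEq.refl _).add (e₁.mul_left _)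
    _ = x₇ * x₃ ^ 2 * x₄ ^ 2 * (x₄ * x₁ + x₃ * x₂) := by ring
    _ ≡ x₇ * x₃ ^ 2 * x₄ ^ 2 * 0 [ZMOD x₅] := e₀.mul_left _
    _ = 0 := by ring

theorem natS_integral (N : ℕ) : ∀ i ≤ N, ((natS i).num : ℚ) = natS i ∧
    ∀ j < i, i ≤ j + 4 → IsCoprime (natS i).num (natS j).num := by
  induction N with
  | zero => intro i hi; obtain rfl : i = 0 := by omega
            simp [natS, somosFive]
  | succ N ih =>
    intro i hi
    rcases Nat.lt_or_ge i (N + 1) with h | h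
    · exact ih i (by omega)
    obtain rfl : i = N + 1 := by omega
    rcases Nat.lt_or_ge N 9 with hN | hN
    · clear ih h hi
      have e0 : natS 0 = (1 : ℤ) := by norm_num [natS, somosFive]
      have e1 : natS 1 = (1 : ℤ) := by norm_num [natS, somosFive]
      have e2 : natS 2 = (1 : ℤ) := by norm_num [natS, somosFive]
      have e3 : natS 3 = (2 : ℤ) := by norm_num [natS, somosFive]
      have e4 : natS 4 = (3 : ℤ) := by norm_num [natS, somosFive]
      have e5 : natS 5 = (5 : ℤ) := by norm_num [natS, somosFive]
      have e6 : natS 6 = (11 : ℤ) := by norm_num [natS, somosFive]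
      have e7 : natS 7 = (37 : ℤ) := by norm_num [natS, somosFive]
      have e8 : natS 8 = (83 : ℤ) := by norm_num [natS, somosFive]
      have e9 : natS 9 = (274 : ℤ) := by norm_num [natS, somosFive]
      interval_cases N <;> refine ⟨by simp only [zero_add, Nat.reduceAdd, *, Rat.num_intCast],
        fun j hj hj' => ?_⟩ <;> interval_cases j <;>
        first
        | omega
        | (simp only [zero_add, Nat.reduceAdd, *, Rat.num_intCast, Int.isCoprime_iff_gcd_eq_one]
           decide)
    · obtain ⟨k, rfl⟩ : ∃ k, N = k + 9 := ⟨N - 9, by omega⟩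
      have hz : ∀ i ≤ k + 9, ((natS i).num : ℚ) = natS i := fun i hi => (ih i hi).1
      have hc : ∀ i ≤ k + 9, ∀ j < i, i ≤ j + 4 → IsCoprime (natS i).num (natS j).num :=
        fun i hi => (ih i hi).2
      have hrec (m : ℕ) (hm : m + 5 ≤ k + 9) : (natS (m + 5)).num * (natS m).num =
          (natS (m + 4)).num * (natS (m + 1)).num + (natS (m + 3)).num * (natS (m + 2)).num := by
        have := natS_somos m
        rw [← hz _ hm, ← hz m (by omega), ← hz (m + 1) (by omega), ← hz (m + 2) (by omega),
          ← hz (m + 3) (by omega), ← hz (m + 4) (by omega)] at this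
        exact_mod_cast this
      obtain ⟨z, h⟩ := dvd_of_somosFive (hrec k (by omega)) ((hrec (k + 1) (by omega)))
        (hrec (k + 2) (by omega)) (hrec (k + 3) (by omega)) (hrec (k + 4) (by omega))
        (hc _ (by omega) _ (by omega) (by omega)) (hc _ (by omega) _ (by omega) (by omega))
        (hc _ (by omega) _ (by omega) (by omega)) (hc _ (by omega) _ (by omega) (by omega))
      have hzq : natS (k + 10) = (z : ℚ) := by
        apply mul_right_cancel₀ (natS_pos (k + 5)).ne'
        rw [natS_somos (k + 5), ← hz (k + 5 + 4) (by omega), ← hz (k + 5 + 3) (by omega),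
          ← hz (k + 5 + 2) (by omega), ← hz (k + 5 + 1) (by omega), ← hz (k + 5) (by omega)]
        have hq := congrArg (Int.cast : ℤ → ℚ) h
        push_cast at hq
        linear_combination hq
      have hnum : (natS (k + 9 + 1)).num = z := by
        rw [show k + 9 + 1 = k + 10 from rfl, hzq, Rat.num_intCast]
      have c98 := hc (k + 9) (by omega) (k + 8) (by omega) (by omega)
      have c97 := hc (k + 9) (by omega) (k + 7) (by omega) (by omega)
      have c96 := hc (k + 9) (by omega) (k + 6) (by omega) (by omega)
      have c87 := hc (k + 8) (by omega) (k + 7) (by omega) (by omega)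
      have c86 := hc (k + 8) (by omega) (k + 6) (by omega) (by omega)
      have c76 := hc (k + 7) (by omega) (k + 6) (by omega) (by omega)
      refine ⟨by rw [hnum, ← hzq], fun j hj hj' => ?_⟩
      rw [hnum]
      have key (a b c d y : ℤ) (hy : y * z = a * b + c * d) (hca : IsCoprime c a)
          (hda : IsCoprime d a) : IsCoprime z a := by
        have : IsCoprime (y * z) a := by
          rw [hy, add_comm]
          exact (IsCoprime.add_mul_left_left_iff).2 (hca.mul_left hda)
        exact this.of_mul_left_right
      obtain rfl | rfl | rfl | rfl : j = k + 6 ∨ j = k + 7 ∨ j = k + 8 ∨ j = k + 9 := by omega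
      · exact key _ (natS (k + 9)).num _ _ _ (by rw [← h]; ring) c86 c76
      · exact key _ (natS (k + 8)).num _ _ _ (by rw [← h]; ring) c97 c76.symm
      · exact key _ (natS (k + 7)).num _ _ _ (by rw [← h]; ring) c98 c86.symm
      · exact key _ (natS (k + 6)).num _ _ _ (by rw [← h]) c98.symm c97.symm

theorem natT_ne_zero_and_adjacent (m : ℕ) : ∀ l : ℚ, (Even m → l = 1) → (Odd m → l = 2) →
    (natT m ≠ 0 ∧ natT (m + 1) ≠ 0 ∧ natT (m + 2) ≠ 0 ∧ natT (m + 3) ≠ 0) ∧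
    Adjacent (l) (natS (m + 1)) (natT m) (natS (m + 2)) (natT (m + 1)) (natS (m + 3))
      (natT (m + 2)) ∧
    Adjacent (3 - l) (natS (m + 2)) (natT (m + 1)) (natS (m + 3)) (natT (m + 2)) (natS (m + 4))
      (natT (m + 3)) ∧
    Adjacent l (natS (m + 3)) (natT (m + 2)) (natS (m + 4)) (natT (m + 3)) (natS (m + 5))
      (natT (m + 4)) := by
  induction m with
  | zero =>
    intro l hl _
    obtain rfl := hl (by simp)
    refine ⟨by norm_num [natT, somosFive], ?_, ?_, ?_⟩ <;> constructor <;>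
      norm_num [natT, natS, somosFive]
  | succ m ih =>
    intro l hl hl'
    have hl0 : l = 1 ∨ l = 2 := (Nat.even_or_odd (m + 1)).imp hl hl'
    obtain ⟨⟨t0, t1, t2, t3⟩, a, b, c⟩ := ih (3 - l)
      (fun h => by rw [hl' h.add_one]; norm_num) (fun h => by rw [hl h.add_one]; norm_num)
    rw [sub_sub_cancel] at b
    have d : Adjacent l (natS (m + 4)) (natT (m + 3)) (natS (m + 5)) (natT (m + 4)) (natS (m + 6))
        (natT (m + 5)) :=
      Adjacent.of_somos hl0 a b c (natS_pos _).ne' (natS_pos _).ne' (natS_pos _).ne'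
        (natS_pos _).ne' t0 t1 t2 t3 (natS_somos (m + 1)) (natT_somos t0)
    refine ⟨⟨t1, t2, t3, fun h => ?_⟩, b, c, d⟩
    have hd := d.ss
    obtain ⟨z4, -⟩ := natS_integral _ (m + 4) le_rfl
    obtain ⟨z5, c5⟩ := natS_integral _ (m + 5) le_rfl
    obtain ⟨z6, c6⟩ := natS_integral _ (m + 6) le_rfl
    have c54 := c5 (m + 4) (by omega) (by omega)
    have c65 := c6 (m + 5) (by omega) (by omega)
    have big : 5 ≤ (natS (m + 5)).num := by
      have : natS 5 ≤ natS (m + 5) := natS_mono (by omega)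
      have h5 : natS 5 = 5 := by norm_num [natS, somosFive]
      rw [h5, ← z5] at this
      exact_mod_cast this
    rw [show natT (m + 4) = 0 from h, ← z4, ← z5, ← z6] at hd
    have hdvd : (natS (m + 5)).num ∣ 3 := by
      refine (c54.mul_right c65.symm).dvd_of_dvd_mul_left ?_
      rcases hl0 with rfl | rfl
      · refine ⟨3 * (natS (m + 5)).num, ?_⟩
        have : (natS (m + 4)).num * (natS (m + 6)).num = (natS (m + 5)).num ^ 2 := by
          qify; linear_combination hd
        linear_combination 3 * this
      · refine ⟨2 * (natS (m + 5)).num, ?_⟩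
        have : 3 * ((natS (m + 4)).num * (natS (m + 6)).num) = 2 * (natS (m + 5)).num ^ 2 := by
          qify; linear_combination hd
        linear_combination this
    have := Int.le_of_dvd (by norm_num) hdvd
    omega

theorem S_natCast (m : ℕ) : S m = natS m := rfl

theorem T_natCast_succ (m : ℕ) : T (m + 1 : ℕ) = natT m := by
  have : ((m + 1 : ℕ) : ℤ).sign = 1 := Int.sign_eq_one_of_pos (by positivity)
  rw [T, this, Int.natAbs_natCast, Nat.add_sub_cancel, Int.cast_one, one_mul, natT]

theorem S_neg (n : ℤ) : S (-n) = S n := by simp [S]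

theorem T_neg (n : ℤ) : T (-n) = -T n := by simp [T, Int.sign_neg]

theorem S_ne_zero (n : ℤ) : S n ≠ 0 := (natS_pos n.natAbs).ne'

theorem T_ne_zero {n : ℤ} (hn : n ≠ 0) : T n ≠ 0 := by
  obtain ⟨m, hm⟩ : ∃ m, n.natAbs = m + 1 := ⟨n.natAbs - 1, by omega⟩
  have h : T (m + 1 : ℕ) ≠ 0 := by
    rw [T_natCast_succ]
    rcases Nat.even_or_odd m with h | h
    · exact (natT_ne_zero_and_adjacent m 1 (fun _ => rfl)
        (fun h' => absurd h (Nat.not_even_iff_odd.2 h'))).1.1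
    · exact (natT_ne_zero_and_adjacent m 2 (fun h' => absurd h' (Nat.not_even_iff_odd.2 h))
        (fun _ => rfl)).1.1
  rcases Int.natAbs_eq n with e | e <;> rw [e, hm]
  · exact h
  · rw [T_neg]; exact neg_ne_zero.2 h

/-- The parameter of `Adjacent` belonging to the middle index `n`. -/
def parityParam (n : ℤ) : ℚ := if Even n then 1 else 2

theorem parityParam_eq (n : ℤ) : parityParam n = 1 ∨ parityParam n = 2 := by
  unfold parityParam; split_ifs <;> simp

theorem parityParam_add_one (n : ℤ) : parityParam (n + 1) = 3 - parityParam n := by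
  unfold parityParam
  by_cases h : Even n
  · rw [if_pos h, if_neg (by simpa [Int.even_add_one] using h)]; norm_num
  · rw [if_neg h, if_pos (by simpa [Int.even_add_one] using h)]; norm_num

theorem parityParam_neg (n : ℤ) : parityParam (-n) = parityParam n := by
  simp [parityParam]

theorem adjacent_natCast (m : ℕ) :
    Adjacent (parityParam m) (S (m - 1)) (T (m - 1)) (S m) (T m) (S (m + 1)) (T (m + 1)) := by
  match m with
  | 0 =>
    constructor <;> norm_num [parityParam, S, T, somosFive]
  | 1 =>
    constructor <;> norm_num [parityParam, S, T, somosFive]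
  | m + 2 =>
    have h := (natT_ne_zero_and_adjacent m (parityParam m)
      (fun h => by simp [parityParam, h])
      (fun h => by simp [parityParam, Nat.not_even_iff_odd.2 h])).2.1
    have e : parityParam ((m + 2 : ℕ) : ℤ) = parityParam m := by
      simp [parityParam, parity_simps]
    rw [e]
    simp only [← S_natCast, ← T_natCast_succ] at h
    push_cast at h ⊢
    convert h using 2 <;> ring

theorem adjacent (n : ℤ) :
    Adjacent (parityParam n) (S (n - 1)) (T (n - 1)) (S n) (T n) (S (n + 1)) (T (n + 1)) := by
  obtain ⟨m, rfl | rfl⟩ := n.eq_nat_or_neg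
  · exact adjacent_natCast m
  · have h := (adjacent_natCast m).reflect
    rw [parityParam_neg]
    rw [← T_neg, ← T_neg, ← T_neg, ← S_neg m, ← S_neg ((m : ℤ) + 1), ← S_neg ((m : ℤ) - 1),
      neg_add', neg_sub', sub_neg_eq_add] at h
    exact h
section RatioIdentities

variable {l r s t : ℚ}

theorem ratio_semiperimeter (hl : l = 1 ∨ l = 2) (h₁ : s + t = r * (s * t - (3 - l)))
    (h₂ : r * (s + t) = -(1 + l * (s * t))) :
    -s ^ 3 * (1 - r * t) ^ 2 * (1 + s * r) ^ 2 + s ^ 3 * t ^ 3 * r ^ 3 - r * s ^ 2 * t ^ 2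
      - t ^ 3 * (1 - s * r) ^ 2 * (1 + r * t) ^ 2 = 0 := by
  rcases hl with rfl | rfl <;> grind

theorem ratio_kExpr (hl : l = 1 ∨ l = 2) (h₁ : s + t = r * (s * t - (3 - l)))
    (h₂ : r * (s + t) = -(1 + l * (s * t))) :
    s * 2 * (r - s * t * r ^ 3) * ((1 - r ^ 2 * t ^ 2) * ((1 + s * r) * s ^ 2 * r - t + s * r * t))
      + s ^ 2 * t * ((r + s * t * r ^ 3) * (r - s * t * r ^ 3) - 3 * (r - s * t * r ^ 3) ^ 2)
      + 2 * t ^ 2 * (r + s * t * r ^ 3) * (1 - s * r) ^ 2 * (1 + r * t) ^ 2 =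
    -4 * s * t * (1 - s ^ 2 * r ^ 2) ^ 2 * (1 - r ^ 2 * t ^ 2) * r := by
  rcases hl with rfl | rfl <;> grind

theorem ratio_lExpr (hl : l = 1 ∨ l = 2) (h₁ : s + t = r * (s * t - (3 - l)))
    (h₂ : r * (s + t) = -(1 + l * (s * t))) :
    s * 2 * (r - s * t * r ^ 3) * ((1 - s ^ 2 * r ^ 2) * (s * (1 - r * t) - r * t ^ 2 * (1 + r * t)))
      + s ^ 2 * t * ((r + s * t * r ^ 3) * (r - s * t * r ^ 3) + 3 * (r - s * t * r ^ 3) ^ 2)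
      + 2 * t ^ 2 * (r + s * t * r ^ 3) * (1 - s * r) ^ 2 * (1 + r * t) ^ 2 =
    4 * s ^ 2 * (1 - r ^ 2 * t ^ 2) ^ 2 * (1 - s ^ 2 * r ^ 2) * r := by
  rcases hl with rfl | rfl <;> grind

end RatioIdentities

/-- The two cleared relations, for three pairs `(x, u), (y, v), (z, w)` preceded by `(s₀, t₀)` and
followed by `(s₄, t₄)`, with `s, r, t` the ratios of the three pairs. -/
theorem medians_of_ratios {l r s t x y z u v w s₀ t₀ s₄ t₄ a b c σ k m : ℚ} (hl : l = 1 ∨ l = 2)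
    (h₁ : s + t = r * (s * t - (3 - l))) (h₂ : r * (s + t) = -(1 + l * (s * t)))
    (hx : x ≠ 0) (hz : z ≠ 0) (hs : s ≠ 0) (ht : t ≠ 0)
    (hu : u = s * x) (hv : v = r * y) (hw : w = t * z)
    (hs₀ : s₀ = x * y * (1 - s * r) / z) (ht₀ : t₀ = x * y * (1 + s * r) / (z * t))
    (hs₄ : s₄ = y * z * (1 - r * t) / x) (ht₄ : t₄ = y * z * (1 + r * t) / (x * s))
    (hσ : σ = -(z * s₄ ^ 2 * t₀ ^ 2 * u)) (ha : a = -(y * u * v ^ 3 * w))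
    (hb : b = x * y ^ 3 * z * v) (hc : c = s₀ ^ 2 * x * w * t₄ ^ 2)
    (hk : k = 1 / 2 * s₄ * t₄ * (t₀ * u ^ 2 * v - s₀ * x ^ 2 * y))
    (hm : m = 1 / 2 * s₀ * t₀ * (y * z ^ 2 * s₄ - v * w ^ 2 * t₄)) :
    4 * (σ - c) * k + (σ - a) ^ 2 - (σ - b) ^ 2 - 3 * (σ - c) ^ 2 =
        -4 * (s₀ * z * t₀ * w) ^ 2 * (y * s₄ * v * t₄) ∧
      4 * (σ - c) * m - (σ - b) ^ 2 + 3 * (σ - c) ^ 2 + (σ - a) ^ 2 =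
        4 * (x * s₄ * u * t₄) ^ 2 * (s₀ * y * t₀ * v) := by
  subst hu hv hw hs₀ ht₀ hs₄ ht₄
  have hA : a = x * y ^ 4 * z * (-(s * t * r ^ 3)) := by rw [ha]; ring
  have hB : b = x * y ^ 4 * z * r := by rw [hb]; ring
  have hC : s ^ 2 * c = x * y ^ 4 * z * (t * (1 - s * r) ^ 2 * (1 + r * t) ^ 2) := by
    rw [hc]; field_simp
  have hS : t ^ 2 * σ = x * y ^ 4 * z * (-(s * (1 - r * t) ^ 2 * (1 + s * r) ^ 2)) := by
    rw [hσ]; field_simp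
  have hK : 2 * s * t * k = x * y ^ 4 * z *
      ((1 - r ^ 2 * t ^ 2) * ((1 + s * r) * s ^ 2 * r - t + s * r * t)) := by
    rw [hk]; field_simp; ring
  have hM : 2 * s * t * m = x * y ^ 4 * z *
      ((1 - s ^ 2 * r ^ 2) * (s * (1 - r * t) - r * t ^ 2 * (1 + r * t))) := by
    rw [hm]; field_simp; ring
  have hsum : σ = a + b + c := by
    apply mul_left_cancel₀ (mul_ne_zero (pow_ne_zero 2 hs) (pow_ne_zero 2 ht))
    linear_combination s ^ 2 * hS - s ^ 2 * t ^ 2 * hA - s ^ 2 * t ^ 2 * hB - t ^ 2 * hC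
      + x * y ^ 4 * z * ratio_semiperimeter hl h₁ h₂
  have hR : (x * y * (1 - s * r) / z * z * (x * y * (1 + s * r) / (z * t)) * (t * z)) ^ 2 *
      (y * (y * z * (1 - r * t) / x) * (r * y) * (y * z * (1 + r * t) / (x * s))) * s =
      (x * y ^ 4 * z) ^ 2 * ((1 - s ^ 2 * r ^ 2) ^ 2 * (1 - r ^ 2 * t ^ 2) * r) := by
    field_simp; ring
  have hL : (x * (y * z * (1 - r * t) / x) * (s * x) * (y * z * (1 + r * t) / (x * s))) ^ 2 *
      (x * y * (1 - s * r) / z * y * (x * y * (1 + s * r) / (z * t)) * (r * y)) * t =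
      (x * y ^ 4 * z) ^ 2 * ((1 - r ^ 2 * t ^ 2) ^ 2 * (1 - s ^ 2 * r ^ 2) * r) := by
    field_simp; ring
  have hd : σ - c = x * y ^ 4 * z * (r - s * t * r ^ 3) := by
    linear_combination hsum + hA + hB
  have he : b - a = x * y ^ 4 * z * (r + s * t * r ^ 3) := by linear_combination hB - hA
  have hf : (σ - a) ^ 2 - (σ - b) ^ 2 = (b - a) * (σ - c) + 2 * (b - a) * c := by
    linear_combination (b - a) * hsum
  have hst := mul_ne_zero (pow_ne_zero 2 hs) ht
  generalize x * y ^ 4 * z = G at *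
  constructor <;> apply mul_left_cancel₀ hst
  · have key := ratio_kExpr hl h₁ h₂
    rw [he, hd] at hf
    rw [hd]
    linear_combination s ^ 2 * t * hf + 2 * s * G * (r - s * t * r ^ 3) * hK
      + 2 * t * G * (r + s * t * r ^ 3) * hC + G ^ 2 * key - -4 * s * t * hR
  · have key := ratio_lExpr hl h₁ h₂
    rw [he, hd] at hf
    rw [hd]
    linear_combination s ^ 2 * t * hf + 2 * s * G * (r - s * t * r ^ 3) * hM
      + 2 * t * G * (r + s * t * r ^ 3) * hC + G ^ 2 * key - 4 * s ^ 2 * hL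

theorem kExpr_lExpr_of_generic {n : ℤ} (h₁ : n + 1 ≠ 0) (h₂ : n + 2 ≠ 0) (h₃ : n + 3 ≠ 0) :
    kExpr n =
      -4 * (S n * S (n + 3) * T n * T (n + 3)) ^ 2
        * (S (n + 2) * S (n + 4) * T (n + 2) * T (n + 4)) ∧
    lExpr n =
      4 * (S (n + 1) * S (n + 4) * T (n + 1) * T (n + 4)) ^ 2
        * (S n * S (n + 2) * T n * T (n + 2)) := by
  have hl := parityParam_eq (n + 2)
  have hl' := parityParam_eq (n + 1)
  have a := adjacent (n + 1)
  have b := adjacent (n + 2)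
  have c := adjacent (n + 3)
  rw [show n + 3 = n + 2 + 1 by ring, parityParam_add_one, show n + 2 + 1 = n + 3 by ring] at c
  have b' := b
  rw [show n + 2 = n + 1 + 1 by ring, parityParam_add_one, show n + 1 + 1 = n + 2 by ring] at b'
  have e1 : n + 1 - 1 = n := by ring
  have e2 : n + 1 + 1 = n + 2 := by ring
  have e3 : n + 2 - 1 = n + 1 := by ring
  have e4 : n + 2 + 1 = n + 3 := by ring
  have e5 : n + 3 - 1 = n + 2 := by ring
  have e6 : n + 3 + 1 = n + 4 := by ring
  simp only [e1, e2, e3, e4, e5, e6] at a b b' c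
  have p₁ := S_ne_zero (n + 1)
  have p₂ := S_ne_zero (n + 2)
  have p₃ := S_ne_zero (n + 3)
  have q₁ := T_ne_zero h₁
  have q₂ := T_ne_zero h₂
  have q₃ := T_ne_zero h₃
  have f₁ := a.tt_four q₁ hl' b'
  have f₂ := a.ss_four p₁ hl' b'
  have f₃ := b.tt_four q₂ hl c
  have f₄ := b.ss_four p₂ hl c
  obtain ⟨bs, bt, bm⟩ := b
  generalize parityParam (n + 2) = l at *
  have hk : 2 * l - 1 ≠ 0 := by rcases hl with rfl | rfl <;> norm_num
  have hq : l ^ 2 - 3 * l + 2 = 0 := by rcases hl with rfl | rfl <;> norm_num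
  refine medians_of_ratios (r := T (n + 2) / S (n + 2)) (s := T (n + 1) / S (n + 1))
    (t := T (n + 3) / S (n + 3)) hl ?_ ?_ p₁ p₃ (div_ne_zero q₁ p₁) (div_ne_zero q₃ p₃)
    (div_mul_cancel₀ _ p₁).symm (div_mul_cancel₀ _ p₂).symm (div_mul_cancel₀ _ p₃).symm
    ?_ ?_ ?_ ?_ rfl rfl rfl rfl rfl rfl
  · field_simp
    apply mul_left_cancel₀ hk
    linear_combination S (n + 2) * bm - T (n + 2) * (bt - (3 - l) * bs)
      - S (n + 2) ^ 2 * T (n + 2) * hq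
  · field_simp
    apply mul_left_cancel₀ hk
    linear_combination T (n + 2) * bm + S (n + 2) * (bs + l * bt) - T (n + 2) ^ 2 * S (n + 2) * hq
  · field_simp
    linear_combination f₂
  · field_simp
    linear_combination f₁
  · field_simp
    linear_combination f₄
  · field_simp
    linear_combination f₃

theorem kExpr_lExpr (n : ℤ) :
    kExpr n =
      -4 * (S n * S (n + 3) * T n * T (n + 3)) ^ 2
        * (S (n + 2) * S (n + 4) * T (n + 2) * T (n + 4)) ∧
    lExpr n =
      4 * (S (n + 1) * S (n + 4) * T (n + 1) * T (n + 4)) ^ 2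
        * (S n * S (n + 2) * T n * T (n + 2)) := by
  by_cases h₁ : n + 1 = 0
  · obtain rfl : n = -1 := by omega
    norm_num [kExpr, lExpr, sBar, aBar, bBar, cBar, kBar, lBar, S, T, somosFive,
      show Int.sign 2 = 1 from rfl, show Int.sign 3 = 1 from rfl]
  by_cases h₂ : n + 2 = 0
  · obtain rfl : n = -2 := by omega
    norm_num [kExpr, lExpr, sBar, aBar, bBar, cBar, kBar, lBar, S, T, somosFive,
      show Int.sign 2 = 1 from rfl, show Int.sign 3 = 1 from rfl]
  by_cases h₃ : n + 3 = 0
  · obtain rfl : n = -3 := by omega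
    norm_num [kExpr, lExpr, sBar, aBar, bBar, cBar, kBar, lBar, S, T, somosFive,
      show Int.sign 2 = 1 from rfl, show Int.sign 3 = 1 from rfl]
  exact kExpr_lExpr_of_generic h₁ h₂ h₃

end MainSequence

theorem lemma3p6 (n : ℤ) :
    -- the relation for `P_{a,n}`, wherever its right-hand side is not `0 / 0`
    (n ∉ ({-4, -3, -2, 0} : Set ℤ) →
      MainSequence.kExpr n ≠ 0 ∧
      MainSequence.S n * MainSequence.S (n + 3) * MainSequence.T n * MainSequence.T (n + 3) ≠ 0 ∧
      MainSequence.Pa n = 4 * MainSequence.area n / MainSequence.kExpr n) ∧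
    -- the relation for `M_{b,n}`, wherever its denominator is not `0`
    (n ∉ ({-4, -3, -2, -1, 0} : Set ℤ) →
      MainSequence.area n ≠ 0 ∧
      MainSequence.S (n + 2) * MainSequence.S (n + 3) * MainSequence.T (n + 2)
        * MainSequence.T (n + 3) ≠ 0 ∧
      MainSequence.Mb n = MainSequence.lExpr n / (4 * MainSequence.area n)) ∧
    -- both relations for every `n`, cleared of denominators and of all common factors
    MainSequence.kExpr n =
      -4 * (MainSequence.S n * MainSequence.S (n + 3) * MainSequence.T n
          * MainSequence.T (n + 3)) ^ 2
        * (MainSequence.S (n + 2) * MainSequence.S (n + 4) * MainSequence.T (n + 2)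
          * MainSequence.T (n + 4)) ∧
    MainSequence.lExpr n =
      4 * (MainSequence.S (n + 1) * MainSequence.S (n + 4) * MainSequence.T (n + 1)
          * MainSequence.T (n + 4)) ^ 2
        * (MainSequence.S n * MainSequence.S (n + 2) * MainSequence.T n
          * MainSequence.T (n + 2)) := by
  obtain ⟨hk, hl⟩ := MainSequence.kExpr_lExpr n
  refine ⟨fun hn => ?_, fun hn => ?_, hk, hl⟩
  · simp only [Set.mem_insert_iff, Set.mem_singleton_iff, not_or] at hn
    obtain ⟨n4, n3, n2, n0⟩ := hn
    have s0 := MainSequence.S_ne_zero n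
    have s2 := MainSequence.S_ne_zero (n + 2)
    have s3 := MainSequence.S_ne_zero (n + 3)
    have s4 := MainSequence.S_ne_zero (n + 4)
    have t0 := MainSequence.T_ne_zero n0
    have t2 : MainSequence.T (n + 2) ≠ 0 := MainSequence.T_ne_zero (by omega)
    have t3 : MainSequence.T (n + 3) ≠ 0 := MainSequence.T_ne_zero (by omega)
    have t4 : MainSequence.T (n + 4) ≠ 0 := MainSequence.T_ne_zero (by omega)
    refine ⟨?_, by simp [*], ?_⟩
    · rw [hk]
      simp [*]
    · rw [hk, MainSequence.Pa, MainSequence.area]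
      field_simp
  · simp only [Set.mem_insert_iff, Set.mem_singleton_iff, not_or] at hn
    obtain ⟨n4, n3, n2, n1, n0⟩ := hn
    have s0 := MainSequence.S_ne_zero n
    have s1 := MainSequence.S_ne_zero (n + 1)
    have s2 := MainSequence.S_ne_zero (n + 2)
    have s3 := MainSequence.S_ne_zero (n + 3)
    have s4 := MainSequence.S_ne_zero (n + 4)
    have t0 := MainSequence.T_ne_zero n0
    have t1 : MainSequence.T (n + 1) ≠ 0 := MainSequence.T_ne_zero (by omega)
    have t2 : MainSequence.T (n + 2) ≠ 0 := MainSequence.T_ne_zero (by omega)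
    have t3 : MainSequence.T (n + 3) ≠ 0 := MainSequence.T_ne_zero (by omega)
    have t4 : MainSequence.T (n + 4) ≠ 0 := MainSequence.T_ne_zero (by omega)
    refine ⟨?_, by simp [*], ?_⟩
    · simp [MainSequence.area, *]
    · rw [hl, MainSequence.Mb, MainSequence.area]
      field_simp
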